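/- Theorem A. An indexed grammar over a finite alphabet $\Sigma$ consists of finite sets $N$ of variables and $F$ of indices, a start variable $S \in N$, and finitely many productions, each of one of the forms $A \to \alpha$, $A \to Bf$, $Af \to \alpha$, where $A, B \in N$, $f \in F$, $\alpha \in (N \cup \Sigma)^*$. Sentential forms are words over $NF^* \cup \Sigma$. In one derivation step, one occurrence of a variable with its whole index string is rewritten: for $\delta \in F^*$, $A \to \alpha$ replaces $A\delta$ by $\alpha\cdot\delta$, $A \to Bf$ replaces $A\delta$ by $Bf\delta$, and $Af \to \alpha$ replaces $Af\delta$ by $\alpha\cdot\delta$, where $\alpha\cdot\delta$ is obtained from $\alpha$ by appending $\delta$ to every variable in $\alpha$. A language $L \subseteq \Sigma^*$ is indexed if it is the set of all words in $\Sigma^*$ derivable from $S$ for some such grammar. Let $L$ be an indexed language over a finite alphabet $\Sigma$ and $m$ a positive integer. There is a constant $k > 0$ such that each word $w \in L$ with $|w| \geq k$ can be written as a product $w = w_1 \cdots w_r$ for which the following conditions hold. 1. $m < r \leq k$. 2. The factors $w_i$ are nonempty words. 3. Each choice of $m$ factors is included in a proper subproduct which lies in $L$: for every set $J \subseteq \{1,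 \dots, r\}$ with $|J| = m$ there are $t$ with $m \leq t < r$ and indices $1 \leq i_1 < \cdots < i_t \leq r$ such that $J \subseteq \{i_1, \dots, i_t\}$ and $w_{i_1} \cdots w_{i_t} \in L$. -/

import Mathlib

/-- Productions of an indexed grammar with terminals `T`, variables `N` and indices `F`. -/
inductive IndexedRule (T N F : Type*) where
  /-- The production `A → α`, with `α` a string of variables and terminals. -/
  | plain (A : N) (α : List (Symbol T N))
  /-- The production `A → B f`. -/
  | push (A B : N) (f : F)
  /-- The production `A f → α`, with `α` a string of variables and terminals. -/
  | pop (A : N) (f : F) (α : List (Symbol T N))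

/-- Sentential forms: strings over `N F* ∪ T`. The pair `(A, δ)` is the variable `A` followed by
the index string `δ`, whose first letter is the top of the stack. -/
abbrev IndexedForm (T N F : Type*) := List (Symbol T (N × List F))

/-- Attach the index string `δ` to every variable of a string of variables and terminals. -/
def attachIndices {T N F : Type*} (δ : List F) (α : List (Symbol T N)) : IndexedForm T N F :=
  α.map fun X => match X with
    | .terminal a => .terminal a
    | .nonterminal B => .nonterminal (B, δ)

/-- `r.Expands A ω β`: the production `r` replaces the variable `A` with index string `ω` by the
sentential form `β`. -/
inductive IndexedRule.Expands {T N F : Type*} :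
    IndexedRule T N F → N → List F → IndexedForm T N F → Prop
  | plain (A : N) (α : List (Symbol T N)) (δ : List F) :
      Expands (.plain A α) A δ (attachIndices δ α)
  | push (A B : N) (f : F) (δ : List F) :
      Expands (.push A B f) A δ [.nonterminal (B, f :: δ)]
  | pop (A : N) (f : F) (α : List (Symbol T N)) (δ : List F) :
      Expands (.pop A f α) A (f :: δ) (attachIndices δ α)

/-- Indexed grammars over the terminals `T`, with finitely many variables, indices and
productions. -/
structure IndexedGrammar (T : Type*) where
  /-- The variables. -/
  NT : Type
  /-- The indices. -/
  Index : Type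
  finite_NT : Finite NT
  finite_Index : Finite Index
  /-- The start variable. -/
  initial : NT
  /-- The productions. -/
  rules : Finset (IndexedRule T NT Index)

namespace IndexedGrammar

variable {T : Type*}

/-- One derivation step: one occurrence of a variable with its index string is replaced according
to some production. -/
def Produces (G : IndexedGrammar T) (u v : IndexedForm T G.NT G.Index) : Prop :=
  ∃ ρ ∈ G.rules, ∃ (A : G.NT) (ω : List G.Index) (β p q : IndexedForm T G.NT G.Index),
    ρ.Expands A ω β ∧ u = p ++ [.nonterminal (A, ω)] ++ q ∧ v = p ++ β ++ q

/-- Derivations of any length. -/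
def Derives (G : IndexedGrammar T) (u v : IndexedForm T G.NT G.Index) : Prop :=
  Relation.ReflTransGen G.Produces u v

/-- The language generated by `G`: the terminal words derivable from the start variable with the
empty index string. -/
def language (G : IndexedGrammar T) : Language T :=
  {w : List T | G.Derives [.nonterminal (G.initial, [])] (w.map Symbol.terminal)}

end IndexedGrammar

/-- A language is indexed if some indexed grammar generates it. -/
def Language.IsIndexed {T : Type*} (L : Language T) : Prop :=
  ∃ G : IndexedGrammar T, G.language = L

open List

/-! Two facts carry the proof. The first is Higman's lemma: scattered-subword embedding over a
finite alphabet is a well-quasi-order. Hence any form derivable from a variable `B` shrinks, keeping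
up to `m` marked symbols, to a form of bounded length still derivable from `B`
(`exists_marked_bound`); only finitely many `B` occur, so one bound `K₀` serves all.

The second is `exists_hasWide`: the derivation of a long word contains some `Bγ` which, before `γ`
is touched, produces more than `K = max K₀ m` but boundedly many symbols of nonempty yield. These
yields, with the terminal words on either side, are the factors. Shrinking the form below `B` around
the marked symbols and putting `γ` back drops at least one factor and stays in the language, since
each surviving symbol keeps its own subderivation. -/

/-- In a language over a finite alphabet, every word with a bounded number of marked letters has a
subword of bounded length in the language that keeps all marked letters. -/
theorem exists_bounded_marked_sublist {α : Type*} [Finite α] (M : Set (List α)) (m : ℕ) :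
    ∃ K : ℕ, ∀ z : List (α × Bool), z.map Prod.fst ∈ M → z.countP Prod.snd ≤ m →
      ∃ z', z' <+ z ∧ z'.map Prod.fst ∈ M ∧ z'.countP Prod.snd = z.countP Prod.snd ∧
        z'.length ≤ K := by
  have key : ∀ j : ℕ, ∃ K : ℕ, ∀ z : List (α × Bool), z.map Prod.fst ∈ M →
      z.countP Prod.snd = j →
      ∃ z', z' <+ z ∧ z'.map Prod.fst ∈ M ∧ z'.countP Prod.snd = z.countP Prod.snd ∧
        z'.length ≤ K := by
    intro j
    by_contra! h
    choose z hzM hzj hz using h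
    -- Higman's lemma, with equality on the finite set of marked letters as the underlying
    -- quasi-order.
    have hpwo := Set.PartiallyWellOrderedOn.partiallyWellOrderedOn_sublistForall₂
      (α := α × Bool) (· = ·) (s := Set.univ) (Set.toFinite _).partiallyWellOrderedOn
    have : IsPreorder (List (α × Bool)) (SublistForall₂ (· = ·)) := { }
    obtain ⟨g, hg⟩ := hpwo.exists_monotone_subseq (f := z) (fun n x _ => Set.mem_univ x)
    -- `z (g 0)` embeds in `z (g i)`, whose admissible subwords are all longer than `g i`; but `z (g
    -- 0)` has length only `i ≤ g i`.
    set i := (z (g 0)).length with hi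
    have hs : z (g 0) <+ z (g i) := by
      obtain ⟨l, hl, hl'⟩ := sublistForall₂_iff.1 (hg 0 i (Nat.zero_le _))
      rw [forall₂_eq_eq_eq] at hl
      exact hl ▸ hl'
    have h1 := hz (g i) (z (g 0)) hs (hzM _) (by rw [hzj, hzj])
    have h2 : i ≤ g i := g.strictMono.id_le i
    omega
  choose K hK using key
  refine ⟨(Finset.range (m + 1)).sup K, fun z hz hm => ?_⟩
  obtain ⟨z', h1, h2, h3, h4⟩ := hK _ z hz rfl
  exact ⟨z', h1, h2, h3, h4.trans (Finset.le_sup (by simpa using Nat.lt_succ_of_le hm))⟩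

/-! ### Index strings and weights of forms -/

section Attach

variable {T N F : Type*}

/-- Attach an index string to a single symbol. -/
def attachSymbol (δ : List F) : Symbol T N → Symbol T (N × List F)
  | .terminal a => .terminal a
  | .nonterminal B => .nonterminal (B, δ)

theorem attachIndices_eq_map (δ : List F) (α : List (Symbol T N)) :
    attachIndices δ α = α.map (attachSymbol δ) := by
  exact map_congr_left fun X _ => by cases X <;> rfl

/-- Append an index string to the index strings of a sentential form. -/
def appendIndices (δ : List F) (u : IndexedForm T N F) : IndexedForm T N F :=
  u.map fun X => match X with
    | .terminal a => .terminal a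
    | .nonterminal B => .nonterminal (B.1, B.2 ++ δ)

@[simp]
theorem appendIndices_attachIndices (δ ε : List F) (α : List (Symbol T N)) :
    appendIndices δ (attachIndices ε α) = attachIndices (ε ++ δ) α := by
  simp only [appendIndices, attachIndices, map_map]
  exact map_congr_left fun X _ => by cases X <;> rfl

theorem IndexedRule.Expands.appendIndices {ρ : IndexedRule T N F} {A : N} {ω : List F}
    {β : IndexedForm T N F} (h : ρ.Expands A ω β) (δ : List F) :
    ρ.Expands A (ω ++ δ) (appendIndices δ β) := by
  cases h with
  | plain A α δ' => rw [appendIndices_attachIndices]; exact .plain ..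
  | push A B f δ' => exact .push A B f (_ ++ δ)
  | pop A f α δ' => rw [appendIndices_attachIndices]; exact .pop ..

/-- The number of entries with a nonempty word. -/
def weight {α : Type*} (l : List (α × List T)) : ℕ := l.countP fun x => !x.2.isEmpty

theorem weight_append {α : Type*} (l l' : List (α × List T)) :
    weight (l ++ l') = weight l + weight l' := countP_append

theorem weight_le_length {α : Type*} (l : List (α × List T)) : weight l ≤ l.length :=
  countP_le_length

theorem weight_eq_zero {α : Type*} {l : List (α × List T)}
    (h : (l.map Prod.snd).flatten = []) : weight l = 0 := by
  simp only [weight, countP_eq_zero]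
  intro x hx
  have := flatten_eq_nil_iff.1 h x.2 (mem_map_of_mem hx)
  simp [this]

end Attach

/-! ### Derivations and derivation trees -/

namespace IndexedGrammar

variable {T : Type*} {G : IndexedGrammar T}

theorem Derives.refl (u : IndexedForm T G.NT G.Index) : G.Derives u u := Relation.ReflTransGen.refl

theorem Derives.trans {u v w : IndexedForm T G.NT G.Index} (h : G.Derives u v)
    (h' : G.Derives v w) : G.Derives u w := Relation.ReflTransGen.trans h h'

theorem Derives.context {u v : IndexedForm T G.NT G.Index} (h : G.Derives u v)
    (p q : IndexedForm T G.NT G.Index) : G.Derives (p ++ u ++ q) (p ++ v ++ q) := by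
  refine Relation.ReflTransGen.lift (fun x => p ++ x ++ q) ?_ u v h
  rintro a b ⟨ρ, hρ, A, ω, β, p', q', he, rfl, rfl⟩
  exact ⟨ρ, hρ, A, ω, β, p ++ p', q' ++ q, he, by simp, by simp⟩

theorem Derives.append {u u' v v' : IndexedForm T G.NT G.Index} (h : G.Derives u v)
    (h' : G.Derives u' v') : G.Derives (u ++ u') (v ++ v') := by
  have h1 := h.context [] u'
  have h2 := h'.context v []
  simp only [nil_append, append_nil] at h1 h2
  exact h1.trans h2

/-- A production inspects at most the top index, so a derivation survives putting `δ` at the bottom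
of every stack. -/
theorem Derives.appendIndices {u v : IndexedForm T G.NT G.Index} (h : G.Derives u v)
    (δ : List G.Index) : G.Derives (appendIndices δ u) (appendIndices δ v) := by
  refine Relation.ReflTransGen.lift (_root_.appendIndices δ) ?_ u v h
  rintro a b ⟨ρ, hρ, A, ω, β, p, q, he, rfl, rfl⟩
  exact ⟨ρ, hρ, A, ω ++ δ, _root_.appendIndices δ β, _root_.appendIndices δ p,
    _root_.appendIndices δ q, he.appendIndices δ, by simp [_root_.appendIndices],
    by simp [_root_.appendIndices]⟩

theorem Derives.attach {α α' : List (Symbol T G.NT)} {ε : List G.Index}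
    (h : G.Derives (attachIndices ε α) (attachIndices [] α')) (δ : List G.Index) :
    G.Derives (attachIndices (ε ++ δ) α) (attachIndices δ α') := by
  simpa using h.appendIndices δ

theorem derives_of_expands {ρ : IndexedRule T G.NT G.Index} (hρ : ρ ∈ G.rules) {A : G.NT}
    {ω : List G.Index} {β : IndexedForm T G.NT G.Index} (h : ρ.Expands A ω β) :
    G.Derives [.nonterminal (A, ω)] β :=
  Relation.ReflTransGen.single ⟨ρ, hρ, A, ω, β, [], [], h, by simp, by simp⟩

/-- `G.Yields n X w`: the symbol `X` has a derivation tree of height at most `n` with yield `w`. -/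
def Yields (G : IndexedGrammar T) : ℕ → Symbol T (G.NT × List G.Index) → List T → Prop
  | 0, X, w => ∃ a, X = .terminal a ∧ w = [a]
  | n + 1, X, w => G.Yields n X w ∨
      ∃ ρ ∈ G.rules, ∃ (A : G.NT) (ω : List G.Index) (β : IndexedForm T G.NT G.Index)
        (ws : List (List T)), ρ.Expands A ω β ∧ X = .nonterminal (A, ω) ∧
          Forall₂ (G.Yields n) β ws ∧ w = ws.flatten

theorem derives_of_forall₂ {R : Symbol T (G.NT × List G.Index) → List T → Prop}
    (hR : ∀ X w, R X w → G.Derives [X] (w.map .terminal)) {u : IndexedForm T G.NT G.Index}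
    {ws : List (List T)} (h : Forall₂ R u ws) : G.Derives u (ws.flatten.map .terminal) := by
  induction h with
  | nil => exact .refl _
  | @cons X w u ws h _ ih => simpa using (hR X w h).append ih

theorem Yields.derives {n : ℕ} : ∀ {X : Symbol T (G.NT × List G.Index)} {w : List T},
    G.Yields n X w → G.Derives [X] (w.map .terminal) := by
  induction n with
  | zero =>
    rintro X w ⟨a, rfl, rfl⟩
    exact .refl _
  | succ n ih =>
    rintro X w (h | ⟨ρ, hρ, A, ω, β, ws, he, rfl, hf, rfl⟩)
    · exact ih h
    · exact (derives_of_expands hρ he).trans (derives_of_forall₂ (fun _ _ => ih) hf)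

theorem forall₂_append_left {α β : Type*} {R : α → β → Prop} {p q : List α} {l : List β}
    (h : Forall₂ R (p ++ q) l) : ∃ l₁ l₂, l = l₁ ++ l₂ ∧ Forall₂ R p l₁ ∧ Forall₂ R q l₂ :=
  ⟨l.take p.length, l.drop p.length, (take_append_drop _ _).symm,
    (forall₂_take_append l p q h.flip).flip, (forall₂_drop_append l p q h.flip).flip⟩

theorem Derives.exists_yields {u : IndexedForm T G.NT G.Index} {w : List T}
    (h : G.Derives u (w.map .terminal)) :
    ∃ n ws, Forall₂ (G.Yields n) u ws ∧ w = ws.flatten := by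
  induction h using Relation.ReflTransGen.head_induction_on with
  | refl =>
    refine ⟨0, w.map fun a => [a], ?_, ?_⟩
    · rw [forall₂_map_left_iff, forall₂_map_right_iff, forall₂_same]
      exact fun a _ => ⟨a, rfl, rfl⟩
    · induction w with
      | nil => rfl
      | cons a w ih => simpa using ih
  | head h _ ih =>
    obtain ⟨ρ, hρ, A, ω, β, p, q, he, rfl, rfl⟩ := h
    obtain ⟨n, ws, hf, rfl⟩ := ih
    obtain ⟨ws', ws₃, rfl, hf', h₃⟩ := forall₂_append_left hf
    obtain ⟨ws₁, ws₂, rfl, h₁, h₂⟩ := forall₂_append_left hf'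
    refine ⟨n + 1, ws₁ ++ [ws₂.flatten] ++ ws₃, ?_, by simp⟩
    have hm : ∀ X w, G.Yields n X w → G.Yields (n + 1) X w := fun _ _ => Or.inl
    exact rel_append (rel_append (h₁.imp hm)
      (.cons (Or.inr ⟨ρ, hρ, A, ω, β, ws₂, he, rfl, h₂, rfl⟩) .nil)) (h₃.imp hm)

/-! ### Cuts and wide forms -/

/-- `G.Leaf n δ X w`: the symbol `X` with index string `δ` is a terminal, or the first letter of `δ`
is consumed at once in some derivation tree of height at most `n` with yield `w`. -/
def Leaf (G : IndexedGrammar T) (n : ℕ) (δ : List G.Index) : Symbol T G.NT → List T → Prop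
  | .terminal a, w => w = [a]
  | .nonterminal C, w => ∃ (f : G.Index) (δ' : List G.Index) (α : List (Symbol T G.NT))
      (ws : List (List T)), ∃ n' < n, δ = f :: δ' ∧ .pop C f α ∈ G.rules ∧
        Forall₂ (G.Yields n') (attachIndices δ' α) ws ∧ w = ws.flatten

theorem Leaf.mono {n n' : ℕ} (h : n ≤ n') {δ : List G.Index} {X : Symbol T G.NT} {w : List T}
    (hX : G.Leaf n δ X w) : G.Leaf n' δ X w := by
  cases X with
  | terminal a => exact hX
  | nonterminal C =>
    obtain ⟨f, δ', α, ws, k, hk, h'⟩ := hX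
    exact ⟨f, δ', α, ws, k, hk.trans_le h, h'⟩

theorem Leaf.derives {n : ℕ} {δ : List G.Index} {X : Symbol T G.NT} {w : List T}
    (hX : G.Leaf n δ X w) : G.Derives [attachSymbol δ X] (w.map .terminal) := by
  cases X with
  | terminal a =>
    obtain rfl : w = [a] := hX
    exact .refl _
  | nonterminal C =>
    obtain ⟨f, δ', α, ws, k, hk, rfl, hr, hf, rfl⟩ := hX
    exact (derives_of_expands hr (.pop C f α δ')).trans
      (derives_of_forall₂ (fun _ _ h => h.derives) hf)

theorem derives_of_forall_mem {δ : List G.Index} {l : List (Symbol T G.NT × List T)}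
    (h : ∀ x ∈ l, G.Derives [attachSymbol δ x.1] (x.2.map .terminal)) :
    G.Derives (attachIndices δ (l.map Prod.fst)) ((l.map Prod.snd).flatten.map .terminal) := by
  rw [attachIndices_eq_map]
  induction l with
  | nil => exact .refl _
  | cons x l ih =>
    simpa using (h x (by simp)).append (ih fun y hy => h y (by simp [hy]))

/-- `G.HasCut n u δ w c`: a derivation of `w` from `u` with `δ` below all index strings passes
through a form at which `δ` is first touched, and at most `c` symbols of it have nonempty
yield. -/
def HasCut (G : IndexedGrammar T) (n : ℕ) (u : IndexedForm T G.NT G.Index) (δ : List G.Index)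
    (w : List T) (c : ℕ) : Prop :=
  ∃ l : List (Symbol T G.NT × List T), G.Derives u (attachIndices [] (l.map Prod.fst)) ∧
    w = (l.map Prod.snd).flatten ∧ (∀ x ∈ l, G.Leaf n δ x.1 x.2) ∧ weight l ≤ c

/-- `G.HasWide K K' u w`: a derivation of `w` from `u` passes through a variable with index string
`γ` such that more than `K` and at most `K'` symbols of nonempty yield are derived from that
variable before `γ` is touched. -/
def HasWide (G : IndexedGrammar T) (K K' : ℕ) (u : IndexedForm T G.NT G.Index)
    (w : List T) : Prop :=
  ∃ (p q : List T) (B : G.NT) (γ : List G.Index) (l : List (Symbol T G.NT × List T)),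
    G.Derives u (p.map .terminal ++ [.nonterminal (B, γ)] ++ q.map .terminal) ∧
    w = p ++ (l.map Prod.snd).flatten ++ q ∧
    G.Derives [.nonterminal (B, [])] (attachIndices [] (l.map Prod.fst)) ∧
    (∀ x ∈ l, G.Derives [attachSymbol γ x.1] (x.2.map .terminal)) ∧
    K < weight l ∧ weight l ≤ K'

theorem HasWide.of_derives {K K' : ℕ} {u v : IndexedForm T G.NT G.Index} {w : List T}
    (h : G.Derives u v) (hv : G.HasWide K K' v w) : G.HasWide K K' u w := by
  obtain ⟨p, q, B, γ, l, h1, h2⟩ := hv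
  exact ⟨p, q, B, γ, l, h.trans h1, h2⟩

theorem HasWide.append_left {K K' : ℕ} {u v : IndexedForm T G.NT G.Index} {w w' : List T}
    (hv : G.HasWide K K' v w) (h : G.Derives u (w'.map .terminal)) :
    G.HasWide K K' (u ++ v) (w' ++ w) := by
  obtain ⟨p, q, B, γ, l, h1, rfl, h2⟩ := hv
  exact ⟨w' ++ p, q, B, γ, l, by simpa using h.append h1, by simp, h2⟩

theorem HasWide.append_right {K K' : ℕ} {u v : IndexedForm T G.NT G.Index} {w w' : List T}
    (hv : G.HasWide K K' v w) (h : G.Derives u (w'.map .terminal)) :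
    G.HasWide K K' (v ++ u) (w ++ w') := by
  obtain ⟨p, q, B, γ, l, h1, rfl, h2⟩ := hv
  exact ⟨p, q ++ w', B, γ, l, by simpa using h1.append h, by simp, h2⟩

theorem HasCut.mono {n n' c c' : ℕ} {u : IndexedForm T G.NT G.Index} {δ : List G.Index}
    {w : List T} (hn : n ≤ n') (hc : c ≤ c') (h : G.HasCut n u δ w c) :
    G.HasCut n' u δ w c' := by
  obtain ⟨l, h1, h2, h3, h4⟩ := h
  exact ⟨l, h1, h2, fun x hx => (h3 x hx).mono hn, h4.trans hc⟩

theorem HasCut.of_derives {n c : ℕ} {u v : IndexedForm T G.NT G.Index} {δ : List G.Index}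
    {w : List T} (h : G.Derives u v) (hv : G.HasCut n v δ w c) : G.HasCut n u δ w c := by
  obtain ⟨l, h1, h2⟩ := hv
  exact ⟨l, h.trans h1, h2⟩

theorem HasCut.append {n c c' : ℕ} {u v : IndexedForm T G.NT G.Index} {δ : List G.Index}
    {w w' : List T} (h : G.HasCut n u δ w c) (h' : G.HasCut n v δ w' c') :
    G.HasCut n (u ++ v) δ (w ++ w') (c + c') := by
  obtain ⟨l, h1, rfl, h3, h4⟩ := h
  obtain ⟨l', h1', rfl, h3', h4'⟩ := h'
  refine ⟨l ++ l', ?_, by simp, ?_, ?_⟩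
  · simpa [attachIndices_eq_map] using h1.append h1'
  · intro x hx
    rcases mem_append.1 hx with hx | hx
    exacts [h3 x hx, h3' x hx]
  · rw [weight_append]
    omega

/-- Cuts of the single symbols concatenate. The bound involves the weight, not the length, because a
symbol with empty yield has a cut of weight zero. -/
theorem hasWide_or_hasCut_of_forall_mem {K K' n b : ℕ} {ε δ : List G.Index}
    {l : List (Symbol T G.NT × List T)}
    (hd : ∀ x ∈ l, G.Derives [attachSymbol (ε ++ δ) x.1] (x.2.map .terminal))
    (h : ∀ x ∈ l, G.HasWide K K' [attachSymbol (ε ++ δ) x.1] x.2 ∨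
      G.HasCut n [attachSymbol ε x.1] δ x.2 b) :
    G.HasWide K K' (attachIndices (ε ++ δ) (l.map Prod.fst)) (l.map Prod.snd).flatten ∨
      G.HasCut n (attachIndices ε (l.map Prod.fst)) δ (l.map Prod.snd).flatten
        (weight l * b) := by
  induction l with
  | nil => exact Or.inr ⟨[], .refl _, rfl, by simp, by simp [weight]⟩
  | cons x l ih =>
    have hd' : ∀ y ∈ l, G.Derives [attachSymbol (ε ++ δ) y.1] (y.2.map .terminal) :=
      fun y hy => hd y (mem_cons_of_mem _ hy)
    have hl := derives_of_forall_mem hd'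
    have ih' := ih hd' fun y hy => h y (mem_cons_of_mem _ hy)
    simp only [attachIndices_eq_map, map_cons, flatten_cons] at hl ih' ⊢
    rcases ih' with ih' | ih'
    · exact Or.inl (ih'.append_left (hd x (by simp)))
    rcases h x (by simp) with hx | hx
    · exact Or.inl (hx.append_right hl)
    right
    have hx' : G.HasCut n [attachSymbol ε x.1] δ x.2 (weight [x] * b) := by
      by_cases hx2 : x.2 = []
      · obtain ⟨l', h1, h2, h3, -⟩ := hx
        exact ⟨l', h1, h2, h3, (weight_eq_zero (h2.symm.trans hx2)).le.trans (Nat.zero_le _)⟩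
      · have : weight [x] = 1 := by simp [weight, hx2]
        rwa [this, one_mul]
    have := hx'.append ih'
    rw [← add_mul, ← weight_append] at this
    exact this

theorem exists_list_of_forall₂_attachIndices {R : Symbol T (G.NT × List G.Index) → List T → Prop}
    {δ : List G.Index} {α : List (Symbol T G.NT)} {ws : List (List T)}
    (h : Forall₂ R (attachIndices δ α) ws) :
    ∃ l : List (Symbol T G.NT × List T), l.map Prod.fst = α ∧ l.map Prod.snd = ws ∧
      ∀ x ∈ l, R (attachSymbol δ x.1) x.2 := by
  rw [attachIndices_eq_map, forall₂_map_left_iff] at h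
  induction h with
  | nil => exact ⟨[], rfl, rfl, by simp⟩
  | @cons X w α ws h _ ih =>
    obtain ⟨l, rfl, rfl, hl⟩ := ih
    exact ⟨(X, w) :: l, rfl, rfl, by simpa [h] using hl⟩

/-- Strong induction on the height. One production multiplies the weight of a cut by a bounded
factor, so the first cut to exceed `K` has weight at most `K * (c * K)` and is wide. -/
theorem Yields.hasWide_or_hasCut {K c : ℕ} (hK : 0 < K) (hc : 0 < c)
    (hplain : ∀ A α, .plain A α ∈ G.rules → α.length ≤ c)
    (hpop : ∀ A f α, .pop A f α ∈ G.rules → α.length ≤ c) :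
    ∀ (n : ℕ) (X : Symbol T G.NT) (δ : List G.Index) (w : List T),
      G.Yields n (attachSymbol δ X) w →
      G.HasWide K (K * (c * K)) [attachSymbol δ X] w ∨
        G.HasCut n [attachSymbol [] X] δ w K := by
  intro n
  induction n using Nat.strong_induction_on with
  | _ n IH =>
  intro X δ w hY
  have term : ∀ (n : ℕ) (a : T) (δ ε : List G.Index) (b : ℕ), 0 < b →
      G.HasCut n [attachSymbol ε (.terminal a)] δ [a] b := fun n a δ ε b hb =>
    ⟨[(.terminal a, [a])], .refl _, rfl, by simp [Leaf], by simpa [weight] using Nat.succ_le_of_lt hb⟩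
  have seq : ∀ n' < n, ∀ (α : List (Symbol T G.NT)) (δ : List G.Index) (ws : List (List T)),
      α.length ≤ c → Forall₂ (G.Yields n') (attachIndices δ α) ws →
      G.HasWide K (K * (c * K)) (attachIndices δ α) ws.flatten ∨
        G.HasCut n' (attachIndices [] α) δ ws.flatten (c * K) := by
    intro n' hn' α δ ws hα hf
    obtain ⟨l, rfl, rfl, hl⟩ := exists_list_of_forall₂_attachIndices hf
    rcases hasWide_or_hasCut_of_forall_mem (ε := []) (δ := δ) (fun x hx => (hl x hx).derives)
      (fun x hx => IH n' hn' x.1 δ x.2 (hl x hx)) with h | h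
    · exact Or.inl h
    · refine Or.inr (h.mono le_rfl (Nat.mul_le_mul_right _ ?_))
      simpa using (weight_le_length l).trans (by simpa using hα)
  -- A cut heavier than `K` is itself a wide form, with `γ = δ` and nothing on either side.
  have close : ∀ (A : G.NT) (b : ℕ), b ≤ K * (c * K) →
      G.HasCut n [.nonterminal (A, [])] δ w b →
      G.HasWide K (K * (c * K)) [.nonterminal (A, δ)] w ∨
        G.HasCut n [.nonterminal (A, [])] δ w K := by
    rintro A b hb ⟨l, h1, h2, h3, h4⟩
    by_cases hl : weight l ≤ K
    · exact Or.inr ⟨l, h1, h2, h3, hl⟩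
    · exact Or.inl ⟨[], [], A, δ, l, .refl _, by simpa using h2, h1,
        fun x hx => (h3 x hx).derives, not_le.1 hl, h4.trans hb⟩
  cases n with
  | zero =>
    obtain ⟨a, hX, rfl⟩ := hY
    cases X with
    | nonterminal C => simp [attachSymbol] at hX
    | terminal b =>
      obtain rfl : b = a := by simpa [attachSymbol] using hX
      exact Or.inr (term _ _ _ _ _ hK)
  | succ n =>
  rcases hY with hY | ⟨ρ, hρ, A, ω, β, ws, he, hX, hf, rfl⟩
  · exact (IH n n.lt_succ_self X δ w hY).imp_right (HasCut.mono n.le_succ le_rfl)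
  cases X with
  | terminal a => simp [attachSymbol] at hX
  | nonterminal C =>
  simp only [attachSymbol, Symbol.nonterminal.injEq, Prod.mk.injEq] at hX
  obtain ⟨rfl, rfl⟩ := hX
  cases he with
  | plain _ α _ =>
    rcases seq n n.lt_succ_self α δ ws (hplain _ _ hρ) hf with h | h
    · exact Or.inl (h.of_derives (derives_of_expands hρ (.plain ..)))
    · exact close C _ (Nat.le_mul_of_pos_left _ hK)
        ((h.of_derives (derives_of_expands hρ (.plain ..))).mono n.le_succ le_rfl)
  | push _ B f _ =>
    obtain ⟨w, _, hw, hnil, rfl⟩ := forall₂_cons_left_iff.1 hf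
    obtain rfl := forall₂_nil_left_iff.1 hnil
    have hpush := fun ω => derives_of_expands hρ (.push C B f ω)
    rw [flatten_singleton] at close ⊢
    -- Cut first where `f :: δ` is touched, giving weight at most `K`. Each variable there pops `f`
    -- at once, leaving at most `c` symbols over `δ` with smaller trees; by induction each has a cut
    -- of weight at most `K`.
    rcases IH n n.lt_succ_self (.nonterminal B) (f :: δ) w hw with h | ⟨l, h1, rfl, h3, h4⟩
    · exact Or.inl (h.of_derives (hpush δ))
    have h1' := Derives.attach (α := [.nonterminal B]) (ε := []) h1
    rcases hasWide_or_hasCut_of_forall_mem (K := K) (K' := K * (c * K)) (n := n) (b := c * K)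
      (ε := [f]) (δ := δ) (l := l)
      (fun x hx => (h3 x hx).derives) (by
        rintro ⟨X, w⟩ hx
        have hleaf := h3 _ hx
        cases X with
        | terminal a =>
          obtain rfl : w = [a] := hleaf
          exact Or.inr (term _ _ _ _ _ (Nat.mul_pos hc hK))
        | nonterminal D =>
          obtain ⟨f', δ', α, ws, k, hk, hfδ, hr, hf, rfl⟩ := hleaf
          obtain ⟨rfl, rfl⟩ := cons.inj hfδ
          have hexp := fun ω => derives_of_expands hr (.pop D f α ω)
          exact (seq k (by omega) α δ ws (hpop _ _ _ hr) hf).imp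
            (fun h => h.of_derives (hexp δ))
            (fun h => (h.of_derives (hexp [])).mono hk.le le_rfl)) with h | h
    · exact Or.inl ((h.of_derives (h1' (f :: δ))).of_derives (hpush δ))
    · exact close C _ (Nat.mul_le_mul_right _ h4)
        (((h.of_derives (h1' [f])).of_derives (hpush [])).mono n.le_succ le_rfl)
  | pop _ f α δ' =>
    -- The stack is touched at once, so the cut is the variable itself.
    refine Or.inr ⟨[(.nonterminal C, ws.flatten)], .refl _, by simp, ?_, ?_⟩
    · simpa using ⟨f, δ', α, ws, n, n.lt_succ_self, rfl, hρ, hf, rfl⟩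
    · exact (weight_le_length _).trans hK

theorem exists_length_bound (G : IndexedGrammar T) : ∃ c, 0 < c ∧
    (∀ A α, .plain A α ∈ G.rules → α.length ≤ c) ∧
    (∀ A f α, .pop A f α ∈ G.rules → α.length ≤ c) := by
  let len : IndexedRule T G.NT G.Index → ℕ := fun ρ => match ρ with
    | .plain _ α => α.length
    | .push _ _ _ => 0
    | .pop _ _ α => α.length
  have h : ∀ ρ ∈ G.rules, len ρ ≤ G.rules.sup len + 1 :=
    fun ρ hρ => (Finset.le_sup hρ).trans (Nat.le_succ _)
  exact ⟨G.rules.sup len + 1, Nat.succ_pos _, fun A α hr => h _ hr, fun A f α hr => h _ hr⟩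

/-- An empty index string cannot be popped, so the cut consists of terminals only. -/
theorem HasCut.length_le {n c : ℕ} {u : IndexedForm T G.NT G.Index} {w : List T}
    (h : G.HasCut n u [] w c) : w.length ≤ c := by
  obtain ⟨l, -, rfl, h3, h4⟩ := h
  refine le_trans (le_of_eq ?_) h4
  clear h4
  induction l with
  | nil => rfl
  | cons x l ih =>
    have hx := h3 x (by simp)
    have ih := ih fun y hy => h3 y (by simp [hy])
    obtain ⟨X, w⟩ := x
    cases X with
    | terminal a =>
      obtain rfl : w = [a] := hx
      simp only [map_cons, flatten_cons, length_append, ih]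
      simp [weight, add_comm]
    | nonterminal C =>
      obtain ⟨_, _, _, _, _, _, h, _⟩ := hx
      cases h

theorem exists_hasWide (G : IndexedGrammar T) {K : ℕ} (hK : 0 < K) :
    ∃ K', ∀ w ∈ G.language, K < w.length → G.HasWide K K' [.nonterminal (G.initial, [])] w := by
  obtain ⟨c, hc, h1, h2⟩ := G.exists_length_bound
  refine ⟨K * (c * K), fun w hw hlen => ?_⟩
  obtain ⟨n, ws, hf, rfl⟩ := Derives.exists_yields hw
  obtain ⟨w, _, hY, hnil, rfl⟩ := forall₂_cons_left_iff.1 hf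
  obtain rfl := forall₂_nil_left_iff.1 hnil
  rw [flatten_singleton] at hlen ⊢
  exact (Yields.hasWide_or_hasCut hK hc h1 h2 n (.nonterminal G.initial) [] _ hY).resolve_right
    fun h => absurd h.length_le (not_le.2 hlen)

end IndexedGrammar

/-! ### Marked factorizations -/

section Factors

variable {T : Type*}

/-- The nonempty words of a list of words. -/
def nonemptyWords (W : List (List T)) : List (List T) := W.filter fun w => !w.isEmpty

theorem flatten_nonemptyWords (W : List (List T)) : (nonemptyWords W).flatten = W.flatten := by
  unfold nonemptyWords
  induction W with
  | nil => rfl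
  | cons w W ih => cases w <;> simp [ih]

theorem length_nonemptyWords_map_snd {α : Type*} (l : List (α × List T)) :
    (nonemptyWords (l.map Prod.snd)).length = weight l := by
  simp [nonemptyWords, weight, countP_eq_length_filter, filter_map, Function.comp_def]

/-- A marking of the nonempty words extends to all words. -/
theorem exists_marking {α : Type*} (l : List (α × List T)) (z : List (List T × Bool))
    (hz : z.map Prod.fst = nonemptyWords (l.map Prod.snd)) :
    ∃ zl : List ((α × List T) × Bool), zl.map Prod.fst = l ∧
      (zl.filter fun x => !x.1.2.isEmpty).map (fun x => (x.1.2, x.2)) = z ∧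
      ∀ x ∈ zl, x.2 = true → x.1.2 ≠ [] := by
  induction l generalizing z with
  | nil =>
    obtain rfl : z = [] := by simpa [nonemptyWords] using hz
    exact ⟨[], rfl, rfl, by simp⟩
  | cons x l ih =>
    obtain ⟨a, w⟩ := x
    by_cases hw : w = []
    · subst hw
      obtain ⟨zl, rfl, h2, h3⟩ := ih z (by simpa [nonemptyWords] using hz)
      exact ⟨((a, []), false) :: zl, rfl, by simpa using h2, by simpa using h3⟩
    · have hz' : z.map Prod.fst = w :: nonemptyWords (l.map Prod.snd) := by
        simpa [nonemptyWords, hw] using hz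
      obtain ⟨⟨w', b⟩, z, rfl, hw', hz''⟩ := map_eq_cons_iff.1 hz'
      obtain rfl : w' = w := hw'
      obtain ⟨zl, rfl, h2, h3⟩ := ih z hz''
      refine ⟨((a, w'), b) :: zl, rfl, ?_, ?_⟩
      · simpa [hw] using h2
      · simpa [hw] using h3

theorem countP_filter_nonempty {α : Type*} {l : List ((α × List T) × Bool)}
    (h : ∀ x ∈ l, x.2 = true → x.1.2 ≠ []) :
    ((l.filter fun x => !x.1.2.isEmpty).map fun x => (x.1.2, x.2)).countP Prod.snd =
      l.countP Prod.snd := by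
  rw [countP_map, countP_filter]
  refine countP_congr fun x hx => ?_
  simpa using h x hx

theorem exists_strictMono_of_sublist {r : ℕ} (u : Fin r → List T) (s : Finset (Fin r))
    {z : List (List T × Bool)} (hz : z <+ ofFn fun j => (u j, decide (j ∈ s)))
    (hs : z.countP Prod.snd = s.card) :
    ∃ i : Fin z.length → Fin r, StrictMono i ∧ (∀ j ∈ s, j ∈ Set.range i) ∧
      (ofFn fun l => u (i l)).flatten = (z.map Prod.fst).flatten := by
  rw [ofFn_eq_map, sublist_map_iff] at hz
  obtain ⟨l, hl, rfl⟩ := hz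
  have hlen : (l.map fun j => (u j, decide (j ∈ s))).length = l.length := length_map _
  have hnd : l.Nodup := (nodup_finRange r).sublist hl
  have hmono : StrictMono l.get := by
    intro a b hab
    exact pairwise_iff_get.1 ((pairwise_lt_finRange r).sublist hl) a b hab
  have hmem : ∀ j ∈ s, j ∈ l := by
    -- Equal mark counts force the sublist to keep every position of `s`.
    have hc : (l.toFinset ∩ s).card = s.card := by
      rw [← hs, countP_map, countP_eq_length_filter, ← toFinset_card_of_nodup (hnd.filter _)]
      congr 1
      ext j
      simp
    have := Finset.eq_of_subset_of_card_le Finset.inter_subset_right hc.ge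
    intro j hj
    rw [← this] at hj
    simpa using (Finset.mem_inter.1 hj).1
  refine ⟨fun a => l.get (a.cast hlen), fun a b hab => hmono (by simpa using hab), ?_, ?_⟩
  · intro j hj
    obtain ⟨a, ha⟩ := mem_iff_get.1 (hmem j hj)
    exact ⟨a.cast hlen.symm, by simpa using ha⟩
  · congr 1
    refine ext_get (by simp) fun a h1 h2 => by simp

/-- The indexed form of the conclusion follows from one about marked lists of factors. -/
theorem exists_factors_of_marked {L : Language T} {m k : ℕ} (W : List (List T))
    (hne : ∀ w ∈ W, w ≠ []) (hm : m < W.length) (hk : W.length ≤ k)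
    (h : ∀ z : List (List T × Bool), z.map Prod.fst = W → z.countP Prod.snd = m →
      ∃ z', z' <+ z ∧ z'.length < z.length ∧ z'.countP Prod.snd = m ∧
        (z'.map Prod.fst).flatten ∈ L) :
    ∃ (r : ℕ) (u : Fin r → List T),
        W.flatten = (List.ofFn u).flatten ∧
        m < r ∧ r ≤ k ∧
        (∀ j, u j ≠ []) ∧
        ∀ s : Finset (Fin r), s.card = m →
          ∃ (t : ℕ) (i : Fin t → Fin r),
            m ≤ t ∧ t < r ∧ StrictMono i ∧
            (∀ j ∈ s, j ∈ Set.range i) ∧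
            (List.ofFn fun l => u (i l)).flatten ∈ L := by
  refine ⟨W.length, W.get, by rw [ofFn_get], hm, hk, fun j => hne _ (get_mem W j), ?_⟩
  rintro s rfl
  obtain ⟨z', h1, h2, h3, h4⟩ := h (ofFn fun j => (W.get j, decide (j ∈ s)))
    (by rw [map_ofFn]; exact ofFn_get W) (by
      rw [ofFn_eq_map, countP_map, countP_eq_length_filter,
        ← toFinset_card_of_nodup ((nodup_finRange _).filter _)]
      congr 1
      ext j
      simp)
  obtain ⟨i, hi, hsi, hf⟩ := exists_strictMono_of_sublist W.get s h1 h3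
  refine ⟨z'.length, i, h3 ▸ countP_le_length, by simpa using h2, hi, hsi, ?_⟩
  rw [hf]
  exact h4

end Factors

/-! ### Shrinking the wide form -/

namespace IndexedGrammar

variable {T : Type*}

theorem exists_marked_bound [Finite T] (G : IndexedGrammar T) (m : ℕ) :
    ∃ K : ℕ, ∀ (A : G.NT) (z : List (Symbol T G.NT × Bool)),
      G.Derives [.nonterminal (A, [])] (attachIndices [] (z.map Prod.fst)) →
      z.countP Prod.snd ≤ m →
      ∃ z', z' <+ z ∧ G.Derives [.nonterminal (A, [])] (attachIndices [] (z'.map Prod.fst)) ∧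
        z'.countP Prod.snd = z.countP Prod.snd ∧ z'.length ≤ K := by
  have := G.finite_NT
  have : Finite (Symbol T G.NT) := by
    have := Fintype.ofFinite T
    have := Fintype.ofFinite G.NT
    infer_instance
  choose K hK using fun A : G.NT => exists_bounded_marked_sublist
    {β : List (Symbol T G.NT) | G.Derives [.nonterminal (A, [])] (attachIndices [] β)} m
  obtain ⟨B, hB⟩ := (Set.finite_range K).bddAbove
  refine ⟨B, fun A z h1 h2 => ?_⟩
  obtain ⟨z', h3, h4, h5, h6⟩ := hK A z h1 h2
  exact ⟨z', h3, h4, h5, h6.trans (hB ⟨A, rfl⟩)⟩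

end IndexedGrammar

open IndexedGrammar in
theorem theoremA {T : Type*} [Finite T] (L : Language T) (hL : L.IsIndexed)
    (m : ℕ) (hm : 0 < m) :
    ∃ k : ℕ, 0 < k ∧ ∀ w ∈ L, k ≤ w.length →
      ∃ (r : ℕ) (u : Fin r → List T),
        w = (List.ofFn u).flatten ∧
        m < r ∧ r ≤ k ∧
        (∀ j, u j ≠ []) ∧
        ∀ s : Finset (Fin r), s.card = m →
          ∃ (t : ℕ) (i : Fin t → Fin r),
            m ≤ t ∧ t < r ∧ StrictMono i ∧
            (∀ j ∈ s, j ∈ Set.range i) ∧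
            (List.ofFn fun l => u (i l)).flatten ∈ L := by
  obtain ⟨G, rfl⟩ := hL
  obtain ⟨K₀, hK₀⟩ := G.exists_marked_bound m
  obtain ⟨K', hK'⟩ := G.exists_hasWide (K := max K₀ m) (lt_max_of_lt_right hm)
  -- At most `K'` factors come from the wide form and two from `p` and `q`; the summand `max K₀ m`
  -- makes the word long enough for `hK'`.
  refine ⟨K' + max K₀ m + 2, by omega, fun w hw hlen => ?_⟩
  obtain ⟨p, q, B, γ, l, h1, rfl, h3, h4, h5, h6⟩ := hK' w hw (by omega)
  have hW : p ++ (l.map Prod.snd).flatten ++ q =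
      (nonemptyWords [p] ++ nonemptyWords (l.map Prod.snd) ++ nonemptyWords [q]).flatten := by
    simp [flatten_nonemptyWords]
  have hl1 : (nonemptyWords [p]).length ≤ 1 := length_filter_le _ _
  have hl2 : (nonemptyWords [q]).length ≤ 1 := length_filter_le _ _
  have hl3 := length_nonemptyWords_map_snd l
  rw [hW]
  apply exists_factors_of_marked
  · intro w hw
    simp only [nonemptyWords, mem_append, mem_filter] at hw
    rcases hw with (⟨-, h⟩ | ⟨-, h⟩) | ⟨-, h⟩ <;> simpa using h
  · simp only [length_append]
    omega
  · simp only [length_append]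
    omega
  intro z hz hzm
  obtain ⟨z₁₂, z₃, rfl, hz', hz₃⟩ := map_eq_append_iff.1 hz
  obtain ⟨z₁, z₂, rfl, hz₁, hz₂⟩ := map_eq_append_iff.1 hz'
  obtain ⟨zl, rfl, rfl, hcount⟩ := exists_marking l z₂ hz₂
  simp only [countP_append] at hzm
  -- The whole form below `B` is shrunk, including symbols of empty yield, which carry no mark.
  obtain ⟨y, hy1, hy2, hy3, hy4⟩ := hK₀ B (zl.map fun x => (x.1.1, x.2))
    (by simpa [Function.comp_def] using h3)
    (by
      rw [countP_map, Function.comp_def]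
      have := countP_filter_nonempty hcount
      exact le_trans this.ge (by omega))
  obtain ⟨y, hy, rfl⟩ := sublist_map_iff.1 hy1
  have hy3' : y.countP Prod.snd = zl.countP Prod.snd := by
    simpa [countP_map, Function.comp_def] using hy3
  have hlz := congrArg length hz₂
  rw [length_map, hl3] at hlz
  set φ : List ((Symbol T G.NT × List T) × Bool) → List (List T × Bool) :=
    fun v => (v.filter fun x => !x.1.2.isEmpty).map (fun x => (x.1.2, x.2)) with hφ
  have hsub : φ y <+ φ zl := (hy.filter _).map _
  -- At most `K₀` symbols survive, whereas more than `K₀` had nonempty yield, so some factor is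
  -- lost.
  have hφlen : (φ y).length < (φ zl).length := by
    have hy5 : (φ y).length ≤ y.length := by
      rw [hφ, length_map]
      exact length_filter_le _ y
    have hy4 : y.length ≤ K₀ := by simpa using hy4
    have : (φ zl).length = weight (zl.map Prod.fst) := hlz
    exact lt_of_le_of_lt (hy5.trans hy4) ((le_max_left K₀ m).trans_lt (h5.trans_eq this.symm))
  have hφcount : (φ y).countP Prod.snd = (φ zl).countP Prod.snd := by
    rw [countP_filter_nonempty hcount, ← hy3']
    exact countP_filter_nonempty fun x hx => hcount x (hy.subset hx)
  refine ⟨z₁ ++ φ y ++ z₃, ((Sublist.refl _).append hsub).append (.refl _), ?_, ?_, ?_⟩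
  · simp only [length_append]
    exact Nat.add_lt_add_right (Nat.add_lt_add_left hφlen _) _
  · simp only [countP_append, hφcount]
    exact hzm
  · simp only [map_append, flatten_append, hz₁, hz₃, flatten_nonemptyWords]
    have hyf : ((φ y).map Prod.fst).flatten = ((y.map Prod.fst).map Prod.snd).flatten := by
      rw [← flatten_nonemptyWords ((y.map Prod.fst).map Prod.snd)]
      simp only [φ, nonemptyWords, filter_map, map_map, Function.comp_def]
    rw [hyf, flatten_singleton, flatten_singleton]
    have hd : G.Derives [.nonterminal (B, γ)]
        (((y.map Prod.fst).map Prod.snd).flatten.map .terminal) := by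
      have hy2' := Derives.attach (α := [.nonterminal B]) (ε := []) hy2 γ
      refine hy2'.trans ?_
      have := derives_of_forall_mem (G := G) (δ := γ) (l := y.map Prod.fst)
        (fun x hx => h4 x ((hy.map _).subset hx))
      simpa [Function.comp_def] using this
    have := h1.trans (hd.context (p.map .terminal) (q.map .terminal))
    rw [← map_append, ← map_append] at this
    exact this
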